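/- Let $T$ be a non-empty string of length $n$ over an arbitrary alphabet. Write: - $g^*$ for the size of a smallest straight-line program (SLP) generating $T$, i.e. the least number of rules of an acyclic grammar with exactly one rule per nonterminal, each of the form $X\to AB$ ($A,B$ nonterminals) or $X\to a$ ($a$ a terminal), that generates exactly $T$; - $b^*$ for the size of a smallest macro scheme of $T$. A macro scheme is a finite set of directives, each of the form $T[i..j]\leftarrow T[i'..j']$ (copy one non-empty substring into another of the same length) or $T[i]\leftarrow c$ (assign a character), from which $T$ is unambiguously reconstructed: for every position, the characters retrieved by finite chains of copies ending in an assigned character are exactly the character of $T$ at that position. Its size is its number of directives; - $r$ (when the alphabet is totally ordered) for the number of maximal equal-letter runs in the Burrows–Wheeler transform of $T$, the last column of the matrix whose rows are the $n$ circular rotations of $T$ sorted lexicographically. Then, with $\overline{\log}\,x := \max\{1,\log_2 x\}$, 1. $g^*\in\mathcal O\!\left(b^*\,\overline{\log}^{\,2}(n/b^*)\right)$, and 2. $g^*\in\mathcal O\!\left(r\,\overline{\log}^{\,2}(n/r)\right)$, where the constants hidden in $\mathcal O$ are absolute (independent of the string, its length and the alphabet). -/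

import Mathlib

/-! Strings over an alphabet `α` are lists `T : List α`; positions are counted from `0`. -/

/-- The right-hand side of the rule of the `i`-th nonterminal of a straight-line program: a single
terminal (`Xᵢ → a`), or two earlier nonterminals (`Xᵢ → Xⱼ Xₖ` with `j, k < i`). -/
inductive SLPRule (α : Type*) (i : ℕ) where
  | terminal (a : α)
  | binary (left right : Fin i)

/-- A straight-line program (a context-free grammar in Chomsky normal form which generates exactly
one string): each nonterminal `X₀, …, X_{size - 1}` has exactly one rule, and there is no cyclic
dependency, the nonterminals being numbered so that a rule only mentions earlier ones.
The size is the number of rules; rules `X → a` are counted too. -/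
structure SLP (α : Type*) where
  size : ℕ
  rule : (i : Fin size) → SLPRule α i
  start : Fin size

/-- The string generated by the nonterminal `Xᵢ`. -/
def SLP.expand {α : Type*} (G : SLP α) (i : Fin G.size) : List α :=
  match G.rule i with
  | .terminal a => [a]
  | .binary j k => G.expand ⟨j, j.isLt.trans i.isLt⟩ ++ G.expand ⟨k, k.isLt.trans i.isLt⟩
termination_by i.val
decreasing_by
  · exact j.isLt
  · exact k.isLt

/-- The string generated by a straight-line program. -/
def SLP.generated {α : Type*} (G : SLP α) : List α := G.expand G.start

/-- `g*`: the size of a smallest straight-line program generating the (nonempty) string `T`. -/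
noncomputable def smallestSLPSize {α : Type*} (T : List α) : ℕ :=
  sInf {g : ℕ | ∃ G : SLP α, G.generated = T ∧ G.size = g}

/-- A directive of a macro scheme: copy `T[src .. src + len - 1]` in `T[dst .. dst + len - 1]`,
or assign the character `c` to `T[pos]`. -/
inductive Directive (α : Type*) where
  | copy (dst src len : ℕ)
  | assign (pos : ℕ) (c : α)

/-- The directive refers to nonempty substrings, or to a position, of a string of length `n`. -/
def Directive.InBounds {α : Type*} (n : ℕ) : Directive α → Prop
  | .copy dst src len => 1 ≤ len ∧ dst + len ≤ n ∧ src + len ≤ n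
  | .assign pos _ => pos < n

/-- `Retrieves M p c`: following the directives of `M`, some finite chain of copies
`T[p] ← T[p₂] ← ⋯ ← T[pₖ] ← c` retrieves the character `c` at position `p`. -/
inductive Retrieves {α : Type*} (M : Finset (Directive α)) : ℕ → α → Prop where
  | assign {pos : ℕ} {c : α} : Directive.assign pos c ∈ M → Retrieves M pos c
  | copy {dst src len k : ℕ} {c : α} : Directive.copy dst src len ∈ M → k < len →
      Retrieves M (src + k) c → Retrieves M (dst + k) c

/-- The finite set of directives `M` is a macro scheme of the string `T`: at each position of `T`
the directives retrieve the character of `T` and no other one. (In particular every directive is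
a true equality between substrings of `T`.) -/
structure IsMacroScheme {α : Type*} (T : List α) (M : Finset (Directive α)) : Prop where
  inBounds : ∀ d ∈ M, d.InBounds T.length
  retrieves_iff : ∀ (p : ℕ) (c : α), Retrieves M p c ↔ T[p]? = some c

/-- `b*`: the number of directives of a smallest macro scheme of `T`. -/
noncomputable def smallestMacroSchemeSize {α : Type*} (T : List α) : ℕ :=
  sInf {b : ℕ | ∃ M : Finset (Directive α), IsMacroScheme T M ∧ M.card = b}

/-- The Burrows-Wheeler transform: the last column of the matrix whose rows are the `n` circular
rotations of `T` in lexicographic order. -/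
def bwt {α : Type*} [LinearOrder α] (T : List α) : List α :=
  (((List.range T.length).map fun k => T.rotate k).insertionSort (· ≤ ·)).filterMap List.getLast?

/-- The number of maximal equal-letter runs of a string (its length after each maximal run has
been collapsed to a single letter). -/
def numRuns {α : Type*} [DecidableEq α] (S : List α) : ℕ := (S.destutter (· ≠ ·)).length

/-- `r`: the number of equal-letter runs in the Burrows-Wheeler transform of `T`. -/
def bwtRuns {α : Type*} [LinearOrder α] (T : List α) : ℕ := numRuns (bwt T)

/-! Both bounds pass through factor complexity: an infinite word extending `T` has at most `s * m`
distinct factors of each length `m ≥ 1` (`HasComplexityLE`), with `s = 2b` for a macro scheme of `b`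
directives and `s = r` for the Burrows–Wheeler transform. For a macro scheme, following copies moves
every factor to one that starts among the last `m` positions written by some directive. For the
transform, passing from length `m` to `m + 1` creates at most `r - 1` new cyclic factors
(`card_take_succ_lt`).

Such an `s` yields a small grammar through a block tree. At each scale `m = 2 ^ j` only `O(s)` pairs
of adjacent aligned blocks are leftmost occurrences, and every factor of length `m` lies in such a
pair (`exists_firstPair_cover`). A block of the next scale is two factors of length `m`, each a
suffix of one stored block followed by a prefix of another. Stored blocks have derivation trees of
height `O(j)`, so cutting them takes `O(j)` new rules. Summing `O(s * j)` over the levels up to `log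
(n / s)` gives `O(s log²)`, and at the top level `O(s)` factors cover `T`. -/

/-! ### Windows of an infinite word -/

/-- The factor of length `m` of the infinite word `f` which starts at position `p`. -/
def window {α : Type*} (f : ℕ → α) (p m : ℕ) : List α := (List.range m).map fun k => f (p + k)

section Window

variable {α : Type*} (f : ℕ → α)

@[simp] theorem length_window (p m : ℕ) : (window f p m).length = m := by simp [window]

theorem window_add (p a b : ℕ) : window f p (a + b) = window f p a ++ window f (p + a) b := by
  simp [window, List.range_add, Function.comp_def, add_assoc]

theorem window_eq_window_iff {p q m : ℕ} :
    window f p m = window f q m ↔ ∀ k < m, f (p + k) = f (q + k) := by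
  simp [window]

theorem window_sub_eq {p q m a b : ℕ} (h : window f p m = window f q m) (hab : a + b ≤ m) :
    window f (p + a) b = window f (q + a) b := by
  rw [window_eq_window_iff] at *
  intro k hk
  simpa [add_assoc] using h (a + k) (by omega)

theorem take_window {p m r : ℕ} (h : r ≤ m) : (window f p m).take r = window f p r := by
  obtain ⟨c, rfl⟩ := Nat.exists_eq_add_of_le h
  rw [window_add, List.take_left' (by simp)]

theorem drop_window {p m r : ℕ} (h : r ≤ m) :
    (window f p m).drop r = window f (p + r) (m - r) := by
  obtain ⟨c, rfl⟩ := Nat.exists_eq_add_of_le h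
  rw [window_add, List.drop_left' (by simp)]
  simp

theorem window_succ (p m : ℕ) : window f p (m + 1) = f p :: window f (p + 1) m := by
  rw [add_comm m 1, window_add]
  simp [window]

end Window

/-! ### Grammars as lists of strings -/

/-- A straight-line grammar, given by the strings which its nonterminals generate: each of them is
a single letter or the concatenation of two earlier ones. -/
inductive IsGrammar {α : Type*} : List (List α) → Prop where
  | nil : IsGrammar []
  | terminal {l : List (List α)} (a : α) : IsGrammar l → IsGrammar (l ++ [[a]])
  | binary {l : List (List α)} {u v : List α} : IsGrammar l → u ∈ l → v ∈ l →
      IsGrammar (l ++ [u ++ v])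

/-- The string `u` has a derivation tree of height at most `h` all whose nodes generate strings
of the list `l`. -/
inductive Derives {α : Type*} (l : List (List α)) : ℕ → List α → Prop where
  | terminal {h : ℕ} {a : α} : [a] ∈ l → Derives l h [a]
  | binary {h : ℕ} {u v : List α} : u ++ v ∈ l → Derives l h u → Derives l h v →
      Derives l (h + 1) (u ++ v)

section Grammar

variable {α : Type*}

theorem IsGrammar.exists_rule {l : List (List α)} (hl : IsGrammar l) (i : Fin l.length) :
    ∃ R : SLPRule α i, match R with
      | .terminal a => l[i] = [a]
      | .binary j k => l[i] = l[j] ++ l[k] := by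
  induction hl with
  | nil => exact i.elim0
  | @terminal l a hl ih =>
    obtain ⟨i, hi⟩ := i
    by_cases h : i < l.length
    · obtain ⟨R, hR⟩ := ih ⟨i, h⟩
      refine ⟨R, ?_⟩
      cases R with
      | terminal a => simpa [List.getElem_append_left h] using hR
      | binary j k =>
        have hj : (j : ℕ) < l.length := j.isLt.trans h
        have hk : (k : ℕ) < l.length := k.isLt.trans h
        simpa [List.getElem_append_left h, List.getElem_append_left hj,
          List.getElem_append_left hk] using hR
    · have : i = l.length := by simp at hi; omega
      subst this
      exact ⟨.terminal a, by simp⟩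
  | @binary l u v hl hu hv ih =>
    obtain ⟨i, hi⟩ := i
    by_cases h : i < l.length
    · obtain ⟨R, hR⟩ := ih ⟨i, h⟩
      refine ⟨R, ?_⟩
      cases R with
      | terminal a => simpa [List.getElem_append_left h] using hR
      | binary j k =>
        have hj : (j : ℕ) < l.length := j.isLt.trans h
        have hk : (k : ℕ) < l.length := k.isLt.trans h
        simpa [List.getElem_append_left h, List.getElem_append_left hj,
          List.getElem_append_left hk] using hR
    · have : i = l.length := by simp at hi; omega
      subst this
      obtain ⟨j, hj, rfl⟩ := List.getElem_of_mem hu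
      obtain ⟨k, hk, rfl⟩ := List.getElem_of_mem hv
      refine ⟨.binary ⟨j, hj⟩ ⟨k, hk⟩, ?_⟩
      simp [List.getElem_append_left hj, List.getElem_append_left hk]

theorem SLP.expand_of_rule_eq_terminal (G : SLP α) {i : Fin G.size} {a : α}
    (h : G.rule i = .terminal a) : G.expand i = [a] := by
  rw [SLP.expand, h]

theorem SLP.expand_of_rule_eq_binary (G : SLP α) {i : Fin G.size} {j k : Fin i}
    (h : G.rule i = .binary j k) :
    G.expand i = G.expand ⟨j, j.isLt.trans i.isLt⟩ ++ G.expand ⟨k, k.isLt.trans i.isLt⟩ := by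
  rw [SLP.expand, h]

theorem IsGrammar.smallestSLPSize_le {l : List (List α)} (hl : IsGrammar l) {T : List α}
    (hT : T ∈ l) : smallestSLPSize T ≤ l.length := by
  obtain ⟨t, ht, rfl⟩ := List.getElem_of_mem hT
  choose R hR using hl.exists_rule
  let G : SLP α := ⟨l.length, R, ⟨t, ht⟩⟩
  have key : ∀ n (h : n < l.length), G.expand ⟨n, h⟩ = l[n] := by
    intro n
    induction n using Nat.strong_induction_on with
    | _ n ih =>
      intro h
      have hR' := hR ⟨n, h⟩
      cases hS : R ⟨n, h⟩ with
      | terminal a =>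
        rw [hS] at hR'
        exact (SLP.expand_of_rule_eq_terminal G hS).trans hR'.symm
      | binary j k =>
        rw [hS] at hR'
        refine (SLP.expand_of_rule_eq_binary G hS).trans (Eq.trans ?_ hR'.symm)
        exact congrArg₂ (· ++ ·) (ih j j.isLt _) (ih k k.isLt _)
  exact Nat.sInf_le ⟨G, key t ht, rfl⟩

theorem Derives.mem {l : List (List α)} {h : ℕ} {u : List α} (hu : Derives l h u) : u ∈ l := by
  cases hu <;> assumption

theorem Derives.mono {l l' : List (List α)} {h h' : ℕ} {u : List α} (hu : Derives l h u)
    (hl : l ⊆ l') (hh : h ≤ h') : Derives l' h' u := by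
  induction hu generalizing h' with
  | terminal ha => exact .terminal (hl ha)
  | binary huv _ _ ihu ihv =>
    obtain ⟨k, rfl⟩ : ∃ k, h' = k + 1 := ⟨h' - 1, by omega⟩
    exact .binary (hl huv) (ihu (by omega)) (ihv (by omega))

/-- The grammar `l` can be extended by at most `c` rules so as to derive `u` in height `h`. -/
def DerivableWith (l : List (List α)) (c h : ℕ) (u : List α) : Prop :=
  ∃ l', IsGrammar l' ∧ l ⊆ l' ∧ l'.length ≤ l.length + c ∧ Derives l' h u

theorem Derives.derivableWith {l : List (List α)} {h : ℕ} {u : List α} (hu : Derives l h u)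
    (hl : IsGrammar l) : DerivableWith l 0 h u :=
  ⟨l, hl, List.Subset.refl l, le_rfl, hu⟩

theorem DerivableWith.mono {l : List (List α)} {c c' h h' : ℕ} {u : List α}
    (H : DerivableWith l c h u) (hc : c ≤ c') (hh : h ≤ h') : DerivableWith l c' h' u := by
  obtain ⟨l', h1, h2, h3, h4⟩ := H
  exact ⟨l', h1, h2, by omega, h4.mono (List.Subset.refl _) hh⟩

/-- The rules for `v` are added after those for `u`, hence the assumption on every extension of `l`.
-/
theorem DerivableWith.append {l : List (List α)} {c d h : ℕ} {u v : List α}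
    (hu : DerivableWith l c h u)
    (hv : ∀ l', IsGrammar l' → l ⊆ l' → DerivableWith l' d h v) :
    DerivableWith l (c + d + 1) (h + 1) (u ++ v) := by
  obtain ⟨l₁, g₁, s₁, n₁, d₁⟩ := hu
  obtain ⟨l₂, g₂, s₂, n₂, d₂⟩ := hv l₁ g₁ s₁
  have s₃ : l₂ ⊆ l₂ ++ [u ++ v] := List.subset_append_left _ _
  refine ⟨l₂ ++ [u ++ v], g₂.binary (s₂ d₁.mem) d₂.mem, List.Subset.trans (List.Subset.trans s₁ s₂) s₃, ?_, ?_⟩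
  · simp; omega
  · exact .binary (by simp) (d₁.mono (List.Subset.trans s₂ s₃) le_rfl) (d₂.mono s₃ le_rfl)

/-- Only the nodes on the path to the cut change, at most one new rule per level. The bound on `r`
keeps the result nonempty, as every derivable string must be. -/
theorem Derives.drop {l : List (List α)} (hl : IsGrammar l) {h : ℕ} {u : List α}
    (hu : Derives l h u) {r : ℕ} (hr : r < u.length) : DerivableWith l h h (u.drop r) := by
  induction hu generalizing r with
  | @terminal h a ha =>
    obtain rfl : r = 0 := by simpa using hr
    exact ((Derives.terminal ha).derivableWith hl).mono (Nat.zero_le _) le_rfl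
  | @binary h u v huv hu hv ihu ihv =>
    by_cases hru : r < u.length
    · rw [List.drop_append_of_le_length hru.le]
      exact (ihu hru).append fun l' hl' hs =>
        (hv.mono hs le_rfl).derivableWith hl'
    · obtain ⟨q, rfl⟩ := Nat.exists_eq_add_of_le (not_lt.mp hru)
      rw [List.drop_length_add_append]
      exact (ihv (by simpa using hr)).mono (by omega) (by omega)

theorem Derives.take {l : List (List α)} (hl : IsGrammar l) {h : ℕ} {u : List α}
    (hu : Derives l h u) {r : ℕ} (hr : 0 < r) : DerivableWith l h h (u.take r) := by
  induction hu generalizing r with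
  | @terminal h a ha =>
    rw [List.take_of_length_le (by simp; omega)]
    exact ((Derives.terminal ha).derivableWith hl).mono (Nat.zero_le _) le_rfl
  | @binary h u v huv hu hv ihu ihv =>
    by_cases hru : r ≤ u.length
    · rw [List.take_append_of_le_length hru]
      exact (ihu hr).mono (by omega) (by omega)
    · obtain ⟨q, rfl⟩ := Nat.exists_eq_add_of_le (not_le.mp hru).le
      rw [List.take_length_add_append]
      obtain ⟨l', g', s', n', d'⟩ := ihv (r := q) (by omega)
      have s'' : l' ⊆ l' ++ [u ++ v.take q] := List.subset_append_left _ _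
      exact ⟨l' ++ [u ++ v.take q], g'.binary (s' hu.mem) d'.mem, List.Subset.trans s' s'',
        by simp; omega,
        .binary (by simp) (hu.mono (List.Subset.trans s' s'') le_rfl) (d'.mono s'' le_rfl)⟩

theorem IsGrammar.exists_derives_all {ι : Type*} {l : List (List α)} (hl : IsGrammar l)
    (X : List ι) (Q : ι → List α) (c h : ℕ)
    (step : ∀ x ∈ X, ∀ l', IsGrammar l' → l ⊆ l' → DerivableWith l' c h (Q x)) :
    ∃ l', IsGrammar l' ∧ l ⊆ l' ∧ l'.length ≤ l.length + X.length * c ∧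
      ∀ x ∈ X, Derives l' h (Q x) := by
  induction X with
  | nil => exact ⟨l, hl, List.Subset.refl l, by simp, by simp⟩
  | cons x X ih =>
    obtain ⟨l₁, g₁, s₁, n₁, d₁⟩ := ih fun y hy => step y (List.mem_cons_of_mem _ hy)
    obtain ⟨l₂, g₂, s₂, n₂, d₂⟩ := step x List.mem_cons_self l₁ g₁ s₁
    refine ⟨l₂, g₂, List.Subset.trans s₁ s₂, ?_, ?_⟩
    · rw [List.length_cons, Nat.succ_mul]; omega
    · intro y hy
      rcases List.mem_cons.mp hy with rfl | hy
      · exact d₂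
      · exact (d₁ y hy).mono s₂ le_rfl

end Grammar

/-! ### Block trees -/

/-- The infinite word `f` has at most `s * m` distinct factors of each positive length `m`. -/
def HasComplexityLE {α : Type*} (f : ℕ → α) (s : ℕ) : Prop :=
  ∀ m, 1 ≤ m → ∃ P : Finset (List α), P.card ≤ s * m ∧ ∀ p, window f p m ∈ P

/-- The pair of aligned blocks of length `m` with indices `i` and `i + 1` is the first occurrence
of the string which it spells. -/
def IsFirstPair {α : Type*} (f : ℕ → α) (m i : ℕ) : Prop :=
  ∀ p < i * m, window f p (2 * m) ≠ window f (i * m) (2 * m)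

section BlockTree

variable {α : Type*} {f : ℕ → α} {s : ℕ}

/-- Each first pair `i + 1` is charged to the `m` windows of length `3 * m` starting in block `i`.
These contain the pair, so two equal ones would exhibit an earlier occurrence of a first pair; all
charged windows are distinct. -/
theorem IsFirstPair.card_le {P : Finset (List α)} {m : ℕ} (hm : 1 ≤ m)
    (hP : ∀ p, window f p (3 * m) ∈ P) (I : Finset ℕ) (hI : ∀ i ∈ I, IsFirstPair f m (i + 1)) :
    I.card * m ≤ P.card := by
  classical
  have key : ∀ i ∈ I, ∀ t < m, ∀ j, ∀ u < m, i * m + t < j * m + u → j ∈ I →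
      window f (i * m + t) (3 * m) ≠ window f (j * m + u) (3 * m) := by
    intro i _ t ht j u hu hlt hj heq
    -- The pair `j + 1` sits at offset `m - u` of the later window; the earlier window carries a
    -- copy of it to the left.
    have h := window_sub_eq f heq (a := m - u) (b := 2 * m) (by omega)
    have e : j * m + u + (m - u) = (j + 1) * m := by rw [Nat.succ_mul]; omega
    rw [e] at h
    refine hI j hj _ ?_ h
    rw [Nat.succ_mul]; omega
  have hinj : Set.InjOn (fun x : ℕ × ℕ => window f (x.1 * m + x.2) (3 * m))
      (I ×ˢ Finset.range m : Finset (ℕ × ℕ)) := by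
    rintro ⟨i, t⟩ hit ⟨j, u⟩ hju h
    simp only [Finset.coe_product, Set.mem_prod, Finset.mem_coe, Finset.mem_range] at hit hju
    dsimp only at h
    rcases lt_trichotomy (i * m + t) (j * m + u) with hlt | heq | hlt
    · exact absurd h (key i hit.1 t hit.2 j u hju.2 hlt hju.1)
    · have hdiv : ∀ a b, b < m → (a * m + b) / m = a := fun a b hb => by
        rw [mul_comm, Nat.mul_add_div (by omega), Nat.div_eq_of_lt hb, add_zero]
      have hij : i = j := by rw [← hdiv i t hit.2, heq, hdiv j u hju.2]
      subst hij
      simpa using heq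
    · exact absurd h.symm (key j hju.1 u hju.2 i t hit.2 hlt hit.1)
  have := Finset.card_le_card_of_injOn _ (fun x _ => hP (x.1 * m + x.2)) hinj
  simpa using this

theorem HasComplexityLE.exists_firstPairs (hf : HasComplexityLE f s) {m : ℕ} (hm : 1 ≤ m) :
    ∃ I : Finset ℕ, I.card ≤ 3 * s + 1 ∧ ∀ i, i ∈ I ↔ IsFirstPair f m i := by
  classical
  obtain ⟨P, hPc, hP⟩ := hf (3 * m) (by omega)
  have hbound : ∀ I : Finset ℕ, (∀ i ∈ I, IsFirstPair f m (i + 1)) → I.card ≤ 3 * s := by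
    intro I hI
    have h := (IsFirstPair.card_le hm hP I hI).trans hPc
    exact Nat.le_of_mul_le_mul_right (h.trans_eq (by ring)) hm
  have hfin : {i | IsFirstPair f m (i + 1)}.Finite := by
    by_contra hinf
    obtain ⟨I, hI, hc⟩ := Set.Infinite.exists_subset_card_eq hinf (3 * s + 1)
    have := hbound I fun i hi => hI hi
    omega
  -- Pair `0` is vacuously first and has no preceding block to charge, whence the `+ 1`.
  refine ⟨insert 0 (hfin.toFinset.image (· + 1)), ?_, fun i => ?_⟩
  · refine (Finset.card_insert_le _ _).trans (Nat.succ_le_succ (Finset.card_image_le.trans ?_))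
    exact hbound _ fun i hi => by simpa using hi
  · cases i with
    | zero => simp [IsFirstPair]
    | succ i => simp

/-- Take the leftmost occurrence of the factor and the pair of blocks around it: an earlier copy of
the pair would contain an earlier copy of the factor. -/
theorem exists_firstPair_cover (f : ℕ → α) {m : ℕ} (hm : 1 ≤ m) (p : ℕ) :
    ∃ i, IsFirstPair f m i ∧ ∃ r < m, window f p m = window f (i * m + r) m := by
  classical
  have hex : ∃ q, window f q m = window f p m := ⟨p, rfl⟩
  have hq := Nat.find_spec hex
  have hmin := fun q => Nat.find_min hex (m := q)
  generalize Nat.find hex = q at hq hmin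
  have hdm := Nat.div_add_mod' q m
  have hr := Nat.mod_lt q (show m > 0 by omega)
  refine ⟨q / m, fun p' hp' heq => ?_, q % m, hr, by rw [hdm, hq]⟩
  have h := window_sub_eq f heq (a := q % m) (b := m) (by omega)
  rw [hdm, hq] at h
  exact hmin _ (by omega) h

/-- Every factor of length `m` can be assembled from a suffix and a prefix of two blocks. -/
theorem derivableWith_window {l : List (List α)} {m h : ℕ} (hm : 1 ≤ m) (hl : IsGrammar l)
    (H : ∀ i, IsFirstPair f m i → Derives l h (window f (i * m) m) ∧
      Derives l h (window f ((i + 1) * m) m)) (p : ℕ) :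
    DerivableWith l (2 * h + 1) (h + 1) (window f p m) := by
  obtain ⟨i, hi, r, hr, he⟩ := exists_firstPair_cover f hm p
  obtain ⟨hu, hv⟩ := H i hi
  rw [he]
  -- For `r = 0` the prefix of the second block would be empty, which no grammar derives.
  rcases Nat.eq_zero_or_pos r with rfl | hr0
  · exact (hu.derivableWith hl).mono (by omega) (by omega)
  · have hsplit : window f (i * m + r) m =
        (window f (i * m) m).drop r ++ (window f ((i + 1) * m) m).take r := by
      rw [drop_window f hr.le, take_window f hr.le]
      have e : (i + 1) * m = i * m + r + (m - r) := by rw [Nat.succ_mul]; omega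
      rw [e, ← window_add]
      congr 1; omega
    rw [hsplit]
    refine ((hu.drop hl (by simpa using hr)).append fun l' hl' hs => ?_).mono
      (c := h + h + 1) (by omega) le_rfl
    exact (hv.mono hs le_rfl).take hl' hr0

/-- A level adds at most `2 * (3 * s + 1) ≤ 8 * s` blocks and increases the height by `2`: one for
joining suffix and prefix, one for joining the halves. -/
theorem HasComplexityLE.exists_blockTree (hf : HasComplexityLE f s) (hs : 1 ≤ s) (j : ℕ) :
    ∃ l, IsGrammar l ∧ l.length ≤ 8 * s * ((8 * j + 3) * (j + 1)) ∧
      ∀ i, IsFirstPair f (2 ^ j) i → Derives l (2 * j) (window f (i * 2 ^ j) (2 ^ j)) ∧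
        Derives l (2 * j) (window f ((i + 1) * 2 ^ j) (2 ^ j)) := by
  induction j with
  | zero =>
    obtain ⟨I, hIc, hI⟩ := hf.exists_firstPairs (m := 2 ^ 0) (by simp)
    obtain ⟨l, g, -, n, d⟩ := IsGrammar.nil.exists_derives_all
      (I.toList ++ I.toList.map (· + 1)) (fun i => window f (i * 2 ^ 0) (2 ^ 0)) 1 (2 * 0)
      (fun x _ l' hl' _ => by
        refine ⟨l' ++ [[f (x * 1)]], hl'.terminal _, List.subset_append_left _ _, by simp, ?_⟩
        simpa [window] using Derives.terminal (by simp))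
    refine ⟨l, g, ?_, fun i hi => ⟨d i ?_, d (i + 1) ?_⟩⟩
    · simp at n; omega
    · simpa [hI] using Or.inl hi
    · simpa [hI] using Or.inr hi
  | succ j ih =>
    obtain ⟨l₀, g₀, n₀, d₀⟩ := ih
    obtain ⟨I, hIc, hI⟩ := hf.exists_firstPairs (m := 2 ^ (j + 1)) Nat.one_le_two_pow
    -- Each half costs `2 * (2 * j) + 1` rules and joining them one more, in total `8 * j + 3`.
    obtain ⟨l, g, -, n, d⟩ := g₀.exists_derives_all
      (I.toList ++ I.toList.map (· + 1)) (fun i => window f (i * 2 ^ (j + 1)) (2 ^ (j + 1)))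
      (8 * j + 3) (2 * (j + 1)) (fun x _ l' hl' hs' => by
        have H : ∀ l'', IsGrammar l'' → l' ⊆ l'' → ∀ p, DerivableWith l'' (2 * (2 * j) + 1)
            (2 * j + 1) (window f p (2 ^ j)) := fun l'' hl'' hs'' =>
          derivableWith_window Nat.one_le_two_pow hl'' fun i hi =>
            ⟨(d₀ i hi).1.mono (List.Subset.trans hs' hs'') le_rfl,
              (d₀ i hi).2.mono (List.Subset.trans hs' hs'') le_rfl⟩
        have e : 2 ^ (j + 1) = 2 ^ j + 2 ^ j := by ring
        rw [e, window_add]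
        exact ((H l' hl' (List.Subset.refl _) _).append
          fun l'' hl'' hs'' => H l'' hl'' hs'' _).mono (by omega) (by omega))
    refine ⟨l, g, ?_, fun i hi => ⟨d i ?_, d (i + 1) ?_⟩⟩
    · simp only [List.length_append, List.length_map, Finset.length_toList] at n
      have h1 : (I.card + I.card) * (8 * j + 3) ≤ 8 * s * (8 * j + 3) :=
        Nat.mul_le_mul_right _ (by omega)
      calc l.length ≤ 8 * s * ((8 * j + 3) * (j + 1)) + 8 * s * (8 * j + 3) := by omega
        _ = 8 * s * ((8 * j + 3) * (j + 1 + 1)) := by ring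
        _ ≤ 8 * s * ((8 * (j + 1) + 3) * (j + 1 + 1)) := by gcongr; omega
    · simp [hI, hi]
    · simp [hI, hi]

theorem derivableWith_window_mul {l : List (List α)} {m h : ℕ} (hm : 1 ≤ m) (hl : IsGrammar l)
    (H : ∀ i, IsFirstPair f m i → Derives l h (window f (i * m) m) ∧
      Derives l h (window f ((i + 1) * m) m)) (k : ℕ) :
    DerivableWith l ((k + 1) * (2 * h + 2)) (h + 1 + k) (window f 0 ((k + 1) * m)) := by
  induction k with
  | zero => simpa using (derivableWith_window hm hl H 0).mono (by omega) le_rfl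
  | succ k ih =>
    rw [Nat.succ_mul (k + 1) m, window_add]
    refine (ih.append (d := 2 * h + 1) fun l' hl' hs => ?_).mono ?_ (by omega)
    · exact (derivableWith_window hm hl' (fun i hi => ⟨(H i hi).1.mono hs le_rfl,
        (H i hi).2.mono hs le_rfl⟩) _).mono le_rfl (by omega)
    · rw [Nat.succ_mul (k + 1)]; omega

theorem HasComplexityLE.smallestSLPSize_window_le (hf : HasComplexityLE f s) (hs : 1 ≤ s) {n : ℕ}
    (hn : 1 ≤ n) :
    smallestSLPSize (window f 0 n) ≤ 100 * s * (Nat.log 2 (n / s) + 1) ^ 2 := by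
  set J := Nat.log 2 (n / s) with hJ
  obtain ⟨l, g, hlen, d⟩ := hf.exists_blockTree hs J
  -- Since `n < 2 * s * 2 ^ J`, `2 * s + 1` windows of length `2 ^ J` cover the prefix. Their left
  -- comb has height `O(s + J)`, so the final cut is affordable.
  obtain ⟨l₁, g₁, -, n₁, d₁⟩ := derivableWith_window_mul Nat.one_le_two_pow g d (2 * s)
  have hle : n ≤ (2 * s + 1) * 2 ^ J := by
    have h1 : n / s < 2 ^ (J + 1) := Nat.lt_pow_succ_log_self (by norm_num) _
    have h2 : n < 2 ^ (J + 1) * s := (Nat.div_lt_iff_lt_mul (by omega)).mp h1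
    have h3 : 2 ^ (J + 1) * s = 2 * s * 2 ^ J := by ring
    have h4 : (2 * s + 1) * 2 ^ J = 2 * s * 2 ^ J + 2 ^ J := by ring
    have h5 : 0 < 2 ^ J := by positivity
    rw [h3] at h2
    rw [h4]
    omega
  obtain ⟨l₂, g₂, -, n₂, d₂⟩ := d₁.take g₁ (r := n) (by omega)
  rw [take_window f hle] at d₂
  refine (g₂.smallestSLPSize_le d₂.mem).trans ?_
  have hb : l₂.length ≤ 8 * s * ((8 * J + 3) * (J + 1)) + (2 * s + 1) * (2 * (2 * J) + 2)
      + (2 * J + 1 + 2 * s) := by omega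
  nlinarith [Nat.zero_le J, Nat.mul_le_mul_right J hs, Nat.mul_le_mul_right (J * J) hs,
    Nat.zero_le (s * J), Nat.zero_le (s * J * J)]

theorem HasComplexityLE.smallestSLPSize_window_le_logb (hf : HasComplexityLE f s) (hs : 1 ≤ s)
    {n : ℕ} (hn : 1 ≤ n) :
    (smallestSLPSize (window f 0 n) : ℝ) ≤
      400 * ((s : ℝ) * max 1 (Real.logb 2 ((n : ℝ) / (s : ℝ))) ^ 2) := by
  have h : (smallestSLPSize (window f 0 n) : ℝ) ≤
      100 * s * ((Nat.log 2 (n / s) : ℝ) + 1) ^ 2 := by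
    exact_mod_cast hf.smallestSLPSize_window_le hs hn
  set L := max 1 (Real.logb 2 ((n : ℝ) / (s : ℝ)))
  have h1 : (1 : ℝ) ≤ L := le_max_left _ _
  have hs0 : (0 : ℝ) < s := by exact_mod_cast hs
  have hJ : (Nat.log 2 (n / s) : ℝ) ≤ L := by
    rcases Nat.eq_zero_or_pos (n / s) with h0 | h0
    · rw [h0]; simpa using zero_le_one.trans h1
    · refine le_trans ?_ (le_max_right _ _)
      rw [Real.le_logb_iff_rpow_le (by norm_num) (by positivity), Real.rpow_natCast]
      have h2 : ((2 ^ Nat.log 2 (n / s) : ℕ) : ℝ) ≤ ((n / s : ℕ) : ℝ) :=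
        Nat.cast_le.mpr (Nat.pow_log_le_self 2 (by omega))
      push_cast at h2
      exact h2.trans Nat.cast_div_le
  calc (smallestSLPSize (window f 0 n) : ℝ)
      ≤ 100 * s * ((Nat.log 2 (n / s) : ℝ) + 1) ^ 2 := h
    _ ≤ 100 * s * (2 * L) ^ 2 := by gcongr; linarith
    _ = 400 * (s * L ^ 2) := by ring

end BlockTree

/-! ### Macro schemes -/

section MacroScheme

variable {α : Type*} {T : List α} {M : Finset (Directive α)}

/-- The last `m` positions to which a directive writes, counting downwards. -/
def Directive.lastPositions (m : ℕ) : Directive α → Finset ℕ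
  | .copy dst _ len => (Finset.range m).image fun t => dst + len - 1 - t
  | .assign pos _ => {pos}

theorem Directive.card_lastPositions_le {m : ℕ} (hm : 1 ≤ m) (d : Directive α) :
    (d.lastPositions m).card ≤ m := by
  cases d with
  | copy dst src len => exact Finset.card_image_le.trans (by simp)
  | assign pos c => simpa [Directive.lastPositions] using hm

/-- By following copies, each factor occurs at one of the last positions of a directive. -/
theorem IsMacroScheme.exists_window_eq (hM : IsMacroScheme T M) (a : α) (m : ℕ) {p : ℕ} {c : α}
    (hp : Retrieves M p c) :
    ∃ d ∈ M, ∃ q ∈ d.lastPositions m,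
      window (fun i => T.getD i a) p m = window (fun i => T.getD i a) q m := by
  induction hp with
  | @assign pos c h => exact ⟨_, h, pos, by simp [Directive.lastPositions], rfl⟩
  | @copy dst src len k c h hk _ ih =>
    -- If the window fits inside the copied part, it moves to the source; otherwise it starts among
    -- the last `m` target positions.
    by_cases hkm : k + m ≤ len
    · obtain ⟨d, hd, q, hq, he⟩ := ih
      refine ⟨d, hd, q, hq, Eq.trans ?_ he⟩
      rw [window_eq_window_iff]
      intro i hi
      have hlen := (hM.inBounds _ h).2.2
      have hs : T[src + (k + i)]? = some (T[src + (k + i)]'(by omega)) :=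
        List.getElem?_eq_getElem _
      have hd := (hM.retrieves_iff _ _).mp
        (Retrieves.copy h (show k + i < len by omega) ((hM.retrieves_iff _ _).mpr hs))
      simp only [List.getD_eq_getElem?_getD, add_assoc, hs, hd]
    · refine ⟨_, h, dst + k, ?_, rfl⟩
      simp only [Directive.lastPositions, Finset.mem_image, Finset.mem_range]
      exact ⟨len - 1 - k, by omega, by omega⟩

theorem IsMacroScheme.card_pos (hM : IsMacroScheme T M) (hT : T ≠ []) : 1 ≤ M.card := by
  have h0 : 0 < T.length := List.length_pos_iff.mpr hT
  have h := (hM.retrieves_iff 0 T[0]).mpr (List.getElem?_eq_getElem h0)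
  refine Finset.card_pos.mpr ?_
  generalize T[0] = c at h
  generalize 0 = p at h
  cases h with
  | assign h => exact ⟨_, h⟩
  | copy h => exact ⟨_, h⟩

theorem IsMacroScheme.hasComplexityLE (hM : IsMacroScheme T M) (hT : T ≠ []) (a : α) :
    HasComplexityLE (fun i => T.getD i a) (2 * M.card) := by
  classical
  intro m hm
  -- `T.length` represents the single window made of padding only; it is absorbed by the factor `2`.
  refine ⟨(insert T.length (M.biUnion (Directive.lastPositions m))).image
    fun q => window (fun i => T.getD i a) q m, ?_, fun p => ?_⟩
  · have h1 := Finset.card_biUnion_le_card_mul M (Directive.lastPositions m) m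
      fun d _ => d.card_lastPositions_le hm
    have h2 : 1 ≤ M.card * m := Nat.mul_pos (hM.card_pos hT) hm
    refine (Finset.card_image_le.trans (Finset.card_insert_le _ _)).trans ?_
    rw [mul_assoc]; omega
  · rw [Finset.mem_image]
    by_cases hp : p < T.length
    · obtain ⟨d, hd, q, hq, he⟩ := hM.exists_window_eq a m
        ((hM.retrieves_iff p T[p]).mpr (List.getElem?_eq_getElem hp))
      exact ⟨q, Finset.mem_insert_of_mem (Finset.mem_biUnion.mpr ⟨d, hd, hq⟩), he.symm⟩
    · refine ⟨T.length, Finset.mem_insert_self _ _, ?_⟩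
      rw [window_eq_window_iff]
      intro k _
      rw [List.getD_eq_default _ _ (by omega), List.getD_eq_default _ _ (by omega)]

theorem exists_isMacroScheme (T : List α) : ∃ M : Finset (Directive α), IsMacroScheme T M := by
  classical
  let M : Finset (Directive α) :=
    Finset.univ.image fun i : Fin T.length => Directive.assign i T[i]
  have hmem : ∀ p c, Directive.assign p c ∈ M ↔ T[p]? = some c := by
    intro p c
    simp only [M, Finset.mem_image, Finset.mem_univ, true_and, Directive.assign.injEq,
      List.getElem?_eq_some_iff]
    constructor
    · rintro ⟨i, rfl, rfl⟩
      exact ⟨i.isLt, rfl⟩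
    · rintro ⟨h, rfl⟩
      exact ⟨⟨p, h⟩, rfl, rfl⟩
  refine ⟨M, ?_, fun p c => ⟨fun h => ?_, fun h => .assign ((hmem p c).mpr h)⟩⟩
  · simp only [M, Finset.mem_image, Finset.mem_univ, true_and]
    rintro _ ⟨i, rfl⟩
    exact i.isLt
  · cases h with
    | assign h => exact (hmem _ _).mp h
    | copy h => simp [M] at h

theorem exists_isMacroScheme_card (T : List α) :
    ∃ M : Finset (Directive α), IsMacroScheme T M ∧ M.card = smallestMacroSchemeSize T :=
  by
  obtain ⟨M, hM⟩ := exists_isMacroScheme T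
  exact Nat.sInf_mem (s := {b | ∃ M, IsMacroScheme T M ∧ M.card = b}) ⟨M.card, M, hM, rfl⟩

end MacroScheme

theorem window_getD {α : Type*} (T : List α) (a : α) :
    window (fun i => T.getD i a) 0 T.length = T := by
  refine List.ext_getElem (by simp) fun i h1 h2 => ?_
  simp [window, h2]

/-! ### Runs -/

section Runs

theorem numRuns_cons_cons {α : Type*} [DecidableEq α] (a b : α) (l : List α) :
    numRuns (a :: b :: l) = numRuns (b :: l) + if a = b then 0 else 1 := by
  unfold numRuns
  by_cases h : a = b
  · subst h; simp [List.destutter, List.destutter']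
  · simp [List.destutter, List.destutter', h]

@[simp] theorem numRuns_nil {α : Type*} [DecidableEq α] : numRuns ([] : List α) = 0 := rfl

@[simp] theorem numRuns_singleton {α : Type*} [DecidableEq α] (a : α) : numRuns [a] = 1 := rfl

theorem card_toFinset_le_numRuns {α : Type*} [DecidableEq α] (l : List α) :
    l.toFinset.card ≤ numRuns l := by
  induction l with
  | nil => simp
  | cons a l ih =>
    cases l with
    | nil => simp
    | cons b l =>
      rw [numRuns_cons_cons]
      by_cases h : a = b
      · subst h; simpa using ih
      · rw [List.toFinset_cons, if_neg h]
        exact (Finset.card_insert_le _ _).trans (Nat.succ_le_succ ih)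

/-- A boundary between runs of pairs is a boundary in one of the coordinates, and a nonempty list
has one boundary fewer than runs. -/
theorem numRuns_map_prodMk_lt {ι α β : Type*} [DecidableEq α] [DecidableEq β] (g : ι → α)
    (h : ι → β) {l : List ι} (hl : l ≠ []) :
    numRuns (l.map fun x => (g x, h x)) + 1 ≤ numRuns (l.map g) + numRuns (l.map h) := by
  induction l with
  | nil => exact absurd rfl hl
  | cons a l ih =>
    cases l with
    | nil => simp
    | cons b l =>
      have := ih (by simp)
      simp only [List.map_cons, numRuns_cons_cons, Prod.mk.injEq] at this ⊢
      split_ifs <;> first | omega | (exfalso; tauto)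

/-- In a sorted list equal entries are adjacent, so each value forms a single run. -/
theorem numRuns_le_card_toFinset {α : Type*} [LinearOrder α] {l : List α}
    (hl : l.Pairwise (· ≤ ·)) : numRuns l ≤ l.toFinset.card := by
  induction l with
  | nil => simp
  | cons a l ih =>
    have ih := ih hl.of_cons
    cases l with
    | nil => simp
    | cons b l =>
      rw [numRuns_cons_cons]
      by_cases h : a = b
      · subst h; simpa using ih
      · rw [List.toFinset_cons, if_neg h, Finset.card_insert_of_notMem]
        · omega
        · rw [List.mem_toFinset]
          intro ha
          rw [List.pairwise_cons] at hl
          refine h (le_antisymm (hl.1 b List.mem_cons_self) ?_)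
          rcases List.mem_cons.mp ha with rfl | ha
          · exact le_rfl
          · exact (List.pairwise_cons.mp hl.2).1 a ha

theorem List.lt_of_take_lt_take {α : Type*} [LinearOrder α] (m : ℕ) {x y : List α}
    (h : x.take m < y.take m) : x < y := by
  induction m generalizing x y with
  | zero => simp at h
  | succ m ih =>
    cases y with
    | nil => simp at h
    | cons b y =>
      cases x with
      | nil => exact List.nil_lt_cons b y
      | cons a x =>
        rw [List.take_succ_cons, List.take_succ_cons, List.cons_lt_cons_iff] at h
        rw [List.cons_lt_cons_iff]
        exact h.imp_right (And.imp_right ih)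

theorem List.take_le_take_of_le {α : Type*} [LinearOrder α] (m : ℕ) {x y : List α} (h : x ≤ y) :
    x.take m ≤ y.take m :=
  not_lt.mp fun h' => not_lt.mpr h (List.lt_of_take_lt_take m h')

end Runs

/-! ### The Burrows–Wheeler transform -/

section BWT

/-- The infinite periodic word `T T T ⋯`. -/
def periodicWord {α : Type*} (T : List α) (a : α) (i : ℕ) : α := T.getD (i % T.length) a

theorem rotate_eq_window {α : Type*} (T : List α) (a : α) (k : ℕ) :
    T.rotate k = window (periodicWord T a) k T.length := by
  refine List.ext_getElem (by simp) fun i h1 h2 => ?_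
  have : (i + k) % T.length < T.length := Nat.mod_lt _ (by simp at h1; omega)
  simp [window, periodicWord, List.getElem_rotate, this, add_comm k i]

theorem window_periodicWord_mod {α : Type*} (T : List α) (a : α) (p m : ℕ) :
    window (periodicWord T a) (p % T.length) m = window (periodicWord T a) p m := by
  simp [window_eq_window_iff, periodicWord]

theorem window_periodicWord {α : Type*} (T : List α) (a : α) :
    window (periodicWord T a) 0 T.length = T := by
  rw [← rotate_eq_window, List.rotate_zero]

variable {α : Type*} [LinearOrder α]

/-- The circular rotations of `T` in lexicographic order. -/
def sortedRotations (T : List α) : List (List α) :=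
  ((List.range T.length).map fun k => T.rotate k).insertionSort (· ≤ ·)

theorem mem_sortedRotations {T x : List α} :
    x ∈ sortedRotations T ↔ ∃ k < T.length, T.rotate k = x := by
  rw [sortedRotations, (List.perm_insertionSort _ _).mem_iff]
  simp

theorem pairwise_sortedRotations (T : List α) : (sortedRotations T).Pairwise (· ≤ ·) :=
  List.pairwise_insertionSort _ _

theorem sortedRotations_ne_nil {T : List α} (hT : T ≠ []) : sortedRotations T ≠ [] :=
  List.ne_nil_of_mem (mem_sortedRotations.mpr ⟨0, List.length_pos_iff.mpr hT, rfl⟩)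

theorem bwt_eq_map (T : List α) (a : α) :
    bwt T = (sortedRotations T).map fun x => x.getLastD a := by
  rw [← List.filterMap_eq_map']
  refine List.filterMap_congr fun x hx => ?_
  obtain ⟨k, hk, rfl⟩ := mem_sortedRotations.mp hx
  have : T.rotate k ≠ [] := by
    rw [← List.length_pos_iff, List.length_rotate]; omega
  rw [List.getLastD_eq_getLast?, List.getLast?_eq_getLast_of_ne_nil this, Option.getD_some]

theorem window_mem_map_take {T : List α} (hT : T ≠ []) (a : α) {m : ℕ} (hm : m ≤ T.length)
    (p : ℕ) : window (periodicWord T a) p m ∈ ((sortedRotations T).map (List.take m)) := by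
  rw [List.mem_map]
  refine ⟨T.rotate (p % T.length), mem_sortedRotations.mpr
    ⟨_, Nat.mod_lt _ (List.length_pos_iff.mpr hT), rfl⟩, ?_⟩
  rw [rotate_eq_window T a, take_window _ hm, window_periodicWord_mod]

/-- A factor of length `m + 1` is determined by a letter of the Burrows–Wheeler transform and the
prefix of length `m` of its row. -/
theorem card_take_succ_lt {T : List α} (hT : T ≠ []) {m : ℕ} (hm : m + 1 ≤ T.length) :
    ((sortedRotations T).map (List.take (m + 1))).toFinset.card + 1 ≤
      ((sortedRotations T).map (List.take m)).toFinset.card + bwtRuns T := by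
  have h0 := List.length_pos_iff.mpr hT
  set a := T.head hT
  set g : List α → α := fun x => x.getLastD a
  have h1 : ((sortedRotations T).map (List.take (m + 1))).toFinset ⊆
      ((sortedRotations T).map fun x => (g x, x.take m)).toFinset.image
        fun x => x.1 :: x.2 := by
    intro w hw
    rw [List.mem_toFinset, List.mem_map] at hw
    obtain ⟨x, hx, rfl⟩ := hw
    obtain ⟨k, hk, rfl⟩ := mem_sortedRotations.mp hx
    rw [Finset.mem_image]
    -- Cyclically, the last letter of rotation `k + 1` is the letter at position `k`, just before
    -- that rotation's prefix.
    refine ⟨(g (T.rotate ((k + 1) % T.length)), (T.rotate ((k + 1) % T.length)).take m), ?_, ?_⟩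
    · rw [List.mem_toFinset, List.mem_map]
      exact ⟨_, mem_sortedRotations.mpr ⟨_, Nat.mod_lt _ h0, rfl⟩, rfl⟩
    · have hlast : g (T.rotate ((k + 1) % T.length)) = periodicWord T a k := by
        obtain ⟨n, hn⟩ : ∃ n, T.length = n + 1 := ⟨T.length - 1, by omega⟩
        simp only [g]
        rw [rotate_eq_window T a, window_periodicWord_mod, hn, window_add]
        have : k + 1 + n = k + T.length := by omega
        simp [window, periodicWord, this]
      rw [hlast, rotate_eq_window T a, rotate_eq_window T a, window_periodicWord_mod,
        take_window _ hm, take_window _ (by omega), window_succ]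
  have h2 := numRuns_map_prodMk_lt g (List.take m) (sortedRotations_ne_nil hT)
  have h3 : numRuns ((sortedRotations T).map (List.take m)) ≤
      ((sortedRotations T).map (List.take m)).toFinset.card := by
    convert numRuns_le_card_toFinset ((pairwise_sortedRotations T).map (List.take m)
      fun x y h => List.take_le_take_of_le m h)
  have h4 := card_toFinset_le_numRuns ((sortedRotations T).map fun x => (g x, x.take m))
  have h5 := (Finset.card_le_card h1).trans Finset.card_image_le
  rw [bwtRuns, bwt_eq_map T a]
  change _ ≤ _ + numRuns ((sortedRotations T).map g)
  omega

theorem bwtRuns_pos {T : List α} (hT : T ≠ []) : 1 ≤ bwtRuns T := by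
  have h := card_toFinset_le_numRuns (bwt T)
  refine le_trans (Finset.card_pos.mpr ?_) h
  rw [List.toFinset_nonempty_iff, bwt_eq_map T (T.head hT)]
  simpa using sortedRotations_ne_nil hT

theorem hasComplexityLE_periodicWord {T : List α} (hT : T ≠ []) (a : α) :
    HasComplexityLE (periodicWord T a) (bwtRuns T) := by
  intro m hm
  have hr := bwtRuns_pos hT
  rcases le_or_gt m T.length with hmn | hmn
  · refine ⟨_, ?_, fun p => List.mem_toFinset.mpr (window_mem_map_take hT a hmn p)⟩
    -- Starting from the one empty factor, each step adds at most `r - 1`, so the count is at most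
    -- `1 + (r - 1) * k`, which is at most `r * k` once `k ≥ 1`.
    have key : ∀ k ≤ T.length, ((sortedRotations T).map (List.take k)).toFinset.card + k ≤
        1 + bwtRuns T * k := by
      intro k hk
      induction k with
      | zero =>
        simp only [add_zero, mul_zero]
        refine (Finset.card_le_card (t := {[]}) fun x hx => ?_).trans (by simp)
        simp at hx
        simp [hx]
      | succ k ih =>
        have h1 := ih (by omega)
        have h2 := card_take_succ_lt hT hk
        rw [Nat.mul_succ]
        omega
    have := key m hmn
    omega
  · refine ⟨(Finset.range T.length).image fun p => window (periodicWord T a) p m, ?_, fun p => ?_⟩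
    · refine (Finset.card_image_le.trans (by simpa using hmn.le)).trans ?_
      exact Nat.le_mul_of_pos_left m hr
    · rw [Finset.mem_image]
      exact ⟨p % T.length, Finset.mem_range.mpr (Nat.mod_lt _ (List.length_pos_iff.mpr hT)),
        window_periodicWord_mod T a p m⟩

end BWT

theorem mainTheorem2 :
    (∃ C : ℝ, 0 < C ∧ ∀ (α : Type*) (T : List α), T ≠ [] →
      (smallestSLPSize T : ℝ) ≤ C * ((smallestMacroSchemeSize T : ℝ) *
        max 1 (Real.logb 2 ((T.length : ℝ) / (smallestMacroSchemeSize T : ℝ))) ^ 2)) ∧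
    (∃ C : ℝ, 0 < C ∧ ∀ (α : Type*) [LinearOrder α] (T : List α), T ≠ [] →
      (smallestSLPSize T : ℝ) ≤ C * ((bwtRuns T : ℝ) *
        max 1 (Real.logb 2 ((T.length : ℝ) / (bwtRuns T : ℝ))) ^ 2)) := by
  refine ⟨⟨800, by norm_num, fun α T hT => ?_⟩, ⟨400, by norm_num, fun α _ T hT => ?_⟩⟩
  · obtain ⟨M, hM, hb⟩ := exists_isMacroScheme_card T
    have hpos := hM.card_pos hT
    have h := (hM.hasComplexityLE hT (T.head hT)).smallestSLPSize_window_le_logb (by omega)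
      (List.length_pos_iff.mpr hT)
    rw [window_getD, hb] at h
    rw [hb] at hpos
    generalize smallestMacroSchemeSize T = b at h hpos
    have hb0 : (0 : ℝ) < b := by exact_mod_cast hpos
    have hn : (0 : ℝ) < T.length := by exact_mod_cast List.length_pos_iff.mpr hT
    push_cast at h
    -- With `s = 2 * b`, the doubling only lowers the logarithm and doubles the constant `400`.
    have hlog : max 1 (Real.logb 2 ((T.length : ℝ) / (2 * b))) ≤
        max 1 (Real.logb 2 ((T.length : ℝ) / b)) := by
      gcongr
      · norm_num
      · linarith
    calc (smallestSLPSize T : ℝ)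
        ≤ 400 * (2 * b * max 1 (Real.logb 2 ((T.length : ℝ) / (2 * b))) ^ 2) := h
      _ ≤ 400 * (2 * b * max 1 (Real.logb 2 ((T.length : ℝ) / b)) ^ 2) := by gcongr
      _ = 800 * (b * max 1 (Real.logb 2 ((T.length : ℝ) / b)) ^ 2) := by ring
  · have h := (hasComplexityLE_periodicWord hT (T.head hT)).smallestSLPSize_window_le_logb
      (bwtRuns_pos hT) (List.length_pos_iff.mpr hT)
    rwa [window_periodicWord] at h
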